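/- Let $G$ be a finite simple graph. Write $q(G)$ for the largest eigenvalue of its signless Laplacian matrix $D(G)+A(G)$ (degree matrix plus adjacency matrix), $\alpha(G)$ for its independence number, and $c(G-S)$ for the number of connected components of the graph obtained by deleting the vertex set $S$. For an integer $l\ge 2$, the $l$-toughness of $G$ is $$t_l(G)=\min\left\{\frac{|S|}{c(G-S)} : S\subset V(G),\ c(G-S)\ge l\right\}\quad\text{if } l\le\alpha(G),$$ and $t_l(G)=+\infty$ if $l>\alpha(G)$. Let $K_m$ denote the complete graph on $m$ vertices, $tK_1$ the graph with $t$ vertices and no edges, $\cup$ the disjoint union and $\vee$ the join (the disjoint union together with all edges between the two graphs). Theorem 1.2. Let $b\ge 2$ and $l\ge 2$ be integers, and let $G$ be a connected graph of order $n\ge 6b\left\lceil\frac{l-1}{b}\right\rceil$. Put $$G_*=K_{\lfloor\frac{l-1}{b}\rfloor}\vee\left(K_{n-\lfloor\frac{l-1}{b}\rfloor-l+1}\cup(l-1)K_1\right).$$ If $q(G)\ge q(G_*)$, then $t_l(G)\ge\frac1b$ unless $G$ is isomorphic to $G_*$; and if $G$ is isomorphic to $G_*$, then $t_l(G)<\frac1b$.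 -/

import Mathlib

open scoped ENNReal

namespace SimpleGraph

open Classical in
/-- The signless Laplacian matrix `Q(G) = D(G) + A(G)` of a finite graph. -/
noncomputable def signlessLapMatrix {V : Type*} [Fintype V] (G : SimpleGraph V) : Matrix V V ℝ :=
  G.degMatrix ℝ + G.adjMatrix ℝ

open Classical in
/-- The `Q`-index `q(G)`: the largest eigenvalue of the signless Laplacian matrix. The matrix is
real symmetric, so for a nonempty vertex set the set of real eigenvalues is finite and nonempty,
and the supremum is its maximum. -/
noncomputable def qIndex {V : Type*} [Fintype V] (G : SimpleGraph V) : ℝ :=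
  sSup {μ : ℝ | Module.End.HasEigenvalue (Matrix.toLin' G.signlessLapMatrix) μ}

/-- The number `c(G - S)` of connected components of the graph obtained by deleting `S`. -/
noncomputable def numComponentsDelete {V : Type*} (G : SimpleGraph V) (S : Finset V) : ℕ :=
  Nat.card (G.induce ((S : Set V)ᶜ)).ConnectedComponent

/-- The `l`-toughness `t_l(G)` of a finite graph, for `l ≥ 2`: the minimum of `|S| / c(G - S)` over
the vertex subsets `S` with `c(G - S) ≥ l` if `l ≤ α(G)`, and `+∞` if `l > α(G)`.
There are finitely many `S`, so the infimum is a minimum; `S = V(G)` has `c(G - S) = 0 < l`, so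
only proper subsets contribute. -/
noncomputable def lToughness {V : Type*} [Fintype V] (G : SimpleGraph V) (l : ℕ) : ℝ≥0∞ :=
  if l ≤ G.indepNum then
    ⨅ (S : Finset V) (_ : l ≤ G.numComponentsDelete S),
      (S.card : ℝ≥0∞) / (G.numComponentsDelete S : ℝ≥0∞)
  else ⊤

/-- The join `G ∨ H`: the disjoint union together with all edges between the two parts. -/
def joinGraph {V W : Type*} (G : SimpleGraph V) (H : SimpleGraph W) : SimpleGraph (V ⊕ W) :=
  (G ⊕g H) ⊔ completeBipartiteGraph V W

/-- The graph `K_s ∨ (K_m ∪ t K_1)`. -/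
def joinCompleteUnion (s m t : ℕ) : SimpleGraph (Fin s ⊕ (Fin m ⊕ Fin t)) :=
  joinGraph (completeGraph (Fin s)) (completeGraph (Fin m) ⊕g emptyGraph (Fin t))

end SimpleGraph

/-! Write `t = l - 1` and `s = ⌊t / b⌋`. Failure of the toughness bound gives a set `S` with `c(G -
S) ≥ t + 1` and `c(G - S) > b|S|`. Let `x` be the Perron vector of `G` and `w` a vertex outside `S`
where `x` is largest.

Shifting: pick a set `T` of representatives of distinct components of `G - S`, none of them the
component of `w`. A vertex outside `S` has at most one neighbour in `T`, and if it has one, it is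
neither `w` nor adjacent to `w`. Moving that edge to `w` does not decrease the quadratic form at
`x`, and the resulting graph lies inside `cliqueJoin S T` (`IsShift.qForm_le`); equality of the
images of `x` forces the graphs to agree (`IsShift.eq_cliqueJoin`).

If `|S| ≤ s`, take `|T| = t` and enlarge `S` to size `s`: the shifted graph is the extremal one, so
the hypothesis on the indices forces equality (`Connected.nonempty_iso_of_qIndex_le`).

If `k = |S| > s`, take `|T| = b * k`. With `q` the index of the extremal graph, `joinPoly` is
nonnegative at `(s, t)`; estimates and concavity make it positive at `(k, b * k)`. A positive test
vector then bounds the form of `cliqueJoin S T` strictly by `q`, so `q(G) < q`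
(`Connected.qIndex_lt_joinCompleteUnion`). -/

namespace SimpleGraph

/-! ### Rayleigh quotients and the Perron vector of the signless Laplacian -/

section Spectral

variable {V : Type*} [Fintype V]

open Classical in
lemma signlessLapMatrix_mulVec_apply (G : SimpleGraph V) (x : V → ℝ) (u : V) :
    (G.signlessLapMatrix.mulVec x) u = ∑ v, if G.Adj u v then x u + x v else 0 := by
  simp only [signlessLapMatrix, Matrix.add_mulVec, Pi.add_apply, degMatrix_mulVec_apply,
    degree_eq_sum_if_adj, Finset.sum_mul, adjMatrix_mulVec_apply, neighborFinset_eq_filter,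
    Finset.sum_filter, ← Finset.sum_add_distrib]
  refine Finset.sum_congr rfl fun v _ => ?_
  split_ifs <;> simp

lemma signlessLapMatrix_isHermitian (G : SimpleGraph V) : G.signlessLapMatrix.IsHermitian := by
  classical
  exact (G.isHermitian_degMatrix ℝ).add (isHermitian_adjMatrix ℝ G)

open Classical in
/-- Twice the quadratic form of the signless Laplacian, as a sum over ordered pairs of adjacent
vertices. -/
noncomputable def qForm (G : SimpleGraph V) (x : V → ℝ) : ℝ :=
  ∑ u, ∑ v, if G.Adj u v then (x u + x v) ^ 2 else 0

lemma qForm_eq_dotProduct (G : SimpleGraph V) (x : V → ℝ) :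
    G.qForm x = 2 * (x ⬝ᵥ G.signlessLapMatrix.mulVec x) := by
  classical
  have h1 : x ⬝ᵥ G.signlessLapMatrix.mulVec x
      = ∑ u, ∑ v, if G.Adj u v then x u * (x u + x v) else 0 := by
    simp only [dotProduct, signlessLapMatrix_mulVec_apply, Finset.mul_sum]
    exact Finset.sum_congr rfl fun u _ => Finset.sum_congr rfl fun v _ => by split_ifs <;> simp
  have h2 : x ⬝ᵥ G.signlessLapMatrix.mulVec x
      = ∑ u, ∑ v, if G.Adj u v then x v * (x u + x v) else 0 := by
    rw [h1, Finset.sum_comm]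
    refine Finset.sum_congr rfl fun u _ => Finset.sum_congr rfl fun v _ => ?_
    simp only [G.adj_comm v u, add_comm]
  rw [two_mul]
  nth_rw 1 [h1]
  rw [h2, qForm, ← Finset.sum_add_distrib]
  refine Finset.sum_congr rfl fun u _ => ?_
  rw [← Finset.sum_add_distrib]
  refine Finset.sum_congr rfl fun v _ => ?_
  split_ifs
  · ring
  · simp

lemma qForm_eq_of_mulVec_eq {G : SimpleGraph V} {x : V → ℝ} {q : ℝ}
    (h : G.signlessLapMatrix.mulVec x = q • x) : G.qForm x = 2 * q * (x ⬝ᵥ x) := by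
  rw [qForm_eq_dotProduct, h, dotProduct_smul, smul_eq_mul]; ring

lemma qForm_le_qForm_abs (G : SimpleGraph V) (x : V → ℝ) : G.qForm x ≤ G.qForm |x| := by
  classical
  refine Finset.sum_le_sum fun u _ => Finset.sum_le_sum fun v _ => ?_
  split_ifs
  · simp only [Pi.abs_apply]
    rw [← sq_abs]
    exact pow_le_pow_left₀ (abs_nonneg _) (abs_add_le _ _) 2
  · exact le_rfl

open Classical in
lemma hasEigenvalue_le_qIndex {G : SimpleGraph V} {μ : ℝ}
    (h : Module.End.HasEigenvalue (Matrix.toLin' G.signlessLapMatrix) μ) : μ ≤ G.qIndex :=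
  le_csSup (Module.End.finite_hasEigenvalue _).bddAbove h

open Classical in
lemma posSemidef_qIndex_sub (G : SimpleGraph V) :
    (G.qIndex • (1 : Matrix V V ℝ) - G.signlessLapMatrix).PosSemidef := by
  have hle : ∀ μ, Module.End.HasEigenvalue (Matrix.toLin' G.signlessLapMatrix) μ →
      μ ≤ G.qIndex := fun μ => hasEigenvalue_le_qIndex
  have hA := G.signlessLapMatrix_isHermitian
  generalize G.qIndex = q at hle ⊢
  generalize G.signlessLapMatrix = A at hA hle ⊢
  rw [Matrix.posSemidef_iff_isHermitian_and_spectrum_nonneg]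
  refine ⟨(Matrix.isHermitian_one.smul (IsSelfAdjoint.all _)).sub hA, fun μ hμ => ?_⟩
  have h : q - μ ∈ spectrum ℝ A := by
    rw [spectrum.mem_iff] at hμ ⊢
    contrapose! hμ
    have : algebraMap ℝ (Matrix V V ℝ) μ - (q • 1 - A)
        = -(algebraMap ℝ (Matrix V V ℝ) (q - μ) - A) := by
      rw [Algebra.algebraMap_eq_smul_one, Algebra.algebraMap_eq_smul_one, sub_smul]; abel
    rw [this]
    exact hμ.neg
  rw [← Matrix.spectrum_toLin', ← Module.End.hasEigenvalue_iff_mem_spectrum] at h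
  have := hle _ h
  change 0 ≤ μ
  linarith

lemma qForm_le_qIndex (G : SimpleGraph V) (y : V → ℝ) :
    G.qForm y ≤ 2 * G.qIndex * (y ⬝ᵥ y) := by
  classical
  have h := G.posSemidef_qIndex_sub.dotProduct_mulVec_nonneg y
  rw [Matrix.sub_mulVec, dotProduct_sub, Matrix.smul_mulVec, Matrix.one_mulVec,
    dotProduct_smul, smul_eq_mul, star_trivial] at h
  rw [qForm_eq_dotProduct]
  linarith

/-- A vector on which the positive semidefinite form of `q • 1 - Q` vanishes lies in its kernel, so
maximisers of the Rayleigh quotient are eigenvectors. -/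
lemma mulVec_eq_of_qForm_eq {G : SimpleGraph V} {x : V → ℝ} {q : ℝ}
    (hq : ∀ y, G.qForm y ≤ 2 * q * (y ⬝ᵥ y)) (hx : G.qForm x = 2 * q * (x ⬝ᵥ x)) :
    G.signlessLapMatrix.mulVec x = q • x := by
  classical
  have key : ∀ y, y ⬝ᵥ (q • (1 : Matrix V V ℝ) - G.signlessLapMatrix).mulVec y
      = q * (y ⬝ᵥ y) - y ⬝ᵥ G.signlessLapMatrix.mulVec y := fun y => by
    rw [Matrix.sub_mulVec, dotProduct_sub, Matrix.smul_mulVec, Matrix.one_mulVec,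
      dotProduct_smul, smul_eq_mul]
  have hpsd : (q • (1 : Matrix V V ℝ) - G.signlessLapMatrix).PosSemidef := by
    refine Matrix.PosSemidef.of_dotProduct_mulVec_nonneg
      ((Matrix.isHermitian_one.smul (IsSelfAdjoint.all _)).sub
        G.signlessLapMatrix_isHermitian) fun y => ?_
    have := hq y
    rw [qForm_eq_dotProduct] at this
    rw [star_trivial, key]
    linarith
  rw [qForm_eq_dotProduct] at hx
  have h0 := (hpsd.dotProduct_mulVec_zero_iff x).1 (by rw [star_trivial, key]; linarith)
  rw [Matrix.sub_mulVec, Matrix.smul_mulVec, Matrix.one_mulVec, sub_eq_zero] at h0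
  exact h0.symm

lemma exists_eigenvector_qIndex [Nonempty V] (G : SimpleGraph V) :
    ∃ x : V → ℝ, x ≠ 0 ∧ G.signlessLapMatrix.mulVec x = G.qIndex • x := by
  classical
  have hne : {μ : ℝ | Module.End.HasEigenvalue
      (Matrix.toLin' G.signlessLapMatrix) μ}.Nonempty := by
    refine ⟨G.signlessLapMatrix_isHermitian.eigenvalues (Classical.arbitrary V), ?_⟩
    change Module.End.HasEigenvalue _ _
    rw [Module.End.hasEigenvalue_iff_mem_spectrum, Matrix.spectrum_toLin']
    exact G.signlessLapMatrix_isHermitian.eigenvalues_mem_spectrum_real _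
  have hmem : Module.End.HasEigenvalue (Matrix.toLin' G.signlessLapMatrix) G.qIndex :=
    hne.csSup_mem (Module.End.finite_hasEigenvalue _)
  obtain ⟨x, hx⟩ := hmem.exists_hasEigenvector
  exact ⟨x, hx.2, by simpa using hx.apply_eq_smul⟩

/-- The Perron vector of a connected graph. -/
lemma Connected.exists_pos_eigenvector_qIndex {G : SimpleGraph V} (hG : G.Connected) :
    ∃ x : V → ℝ, (∀ v, 0 < x v) ∧ G.signlessLapMatrix.mulVec x = G.qIndex • x := by
  classical
  have := hG.nonempty
  obtain ⟨x, hx0, hx⟩ := G.exists_eigenvector_qIndex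
  have habs : |x| ⬝ᵥ |x| = x ⬝ᵥ x := by simp [dotProduct]
  have hx' : G.signlessLapMatrix.mulVec |x| = G.qIndex • |x| := by
    refine mulVec_eq_of_qForm_eq G.qForm_le_qIndex (le_antisymm (G.qForm_le_qIndex _) ?_)
    rw [habs, ← qForm_eq_of_mulVec_eq hx]
    exact G.qForm_le_qForm_abs x
  refine ⟨|x|, ?_, hx'⟩
  by_contra! hcon
  obtain ⟨v, hv⟩ := hcon
  -- Where `|x|` vanishes, its eigenvalue equation equates a sum of nonnegative terms to zero, so
  -- zeros spread along edges and, by connectedness, everywhere.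
  have step : ∀ u w, G.Adj u w → |x| u = 0 → |x| w = 0 := by
    intro u w huw hu
    have h := congrFun hx' u
    rw [signlessLapMatrix_mulVec_apply, Pi.smul_apply, hu, smul_zero,
      Finset.sum_eq_zero_iff_of_nonneg] at h
    · simpa [huw] using h w (Finset.mem_univ _)
    · intro i _
      split_ifs
      · simp
      · exact le_rfl
  have hv0 : |x| v = 0 := le_antisymm hv (abs_nonneg _)
  apply hx0
  funext w
  have hw : |x| w = 0 := by
    obtain ⟨p⟩ := hG.preconnected v w
    clear hv
    induction p with
    | nil => exact hv0
    | cons h _ ih => exact ih (step _ _ h hv0)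
  simpa using hw

/-- Comparison with the complete graph through `(a + b)² ≤ 2a² + 2b²`; this is the source of `q ≤ 2n
- 2`. -/
lemma qForm_le_of_card {G : SimpleGraph V} (x : V → ℝ) :
    G.qForm x ≤ 2 * (2 * (Fintype.card V : ℝ) - 2) * (x ⬝ᵥ x) := by
  classical
  have h1 : G.qForm x ≤ ∑ u, ∑ v, if u ≠ v then 2 * (x u * x u) + 2 * (x v * x v) else 0 := by
    refine Finset.sum_le_sum fun u _ => Finset.sum_le_sum fun v _ => ?_
    split_ifs with h h' h'
    · nlinarith [sq_nonneg (x u - x v)]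
    · exact absurd h.ne h'
    · nlinarith [mul_self_nonneg (x u), mul_self_nonneg (x v)]
    · exact le_rfl
  have h2 : ∀ u, (∑ v, if u ≠ v then 2 * (x u * x u) + 2 * (x v * x v) else 0)
      = 2 * ((Fintype.card V : ℝ) - 2) * (x u * x u) + 2 * (x ⬝ᵥ x) := by
    intro u
    have : ∀ v, (if u ≠ v then 2 * (x u * x u) + 2 * (x v * x v) else 0)
        = (2 * (x u * x u) + 2 * (x v * x v)) - if u = v then 4 * (x u * x u) else 0 := by
      intro v
      by_cases h : u = v
      · subst h; simp; ring
      · simp [h]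
    simp only [this, Finset.sum_sub_distrib, Finset.sum_add_distrib, Finset.sum_const,
      Finset.card_univ, Finset.sum_ite_eq, Finset.mem_univ, if_true, ← Finset.mul_sum, dotProduct,
      nsmul_eq_mul]
    ring
  refine h1.trans (le_of_eq ?_)
  simp only [h2, Finset.sum_add_distrib, Finset.sum_const, ← Finset.mul_sum, Finset.card_univ,
    nsmul_eq_mul]
  simp only [dotProduct]
  ring

end Spectral

/-! ### Shifting edges towards a vertex of largest weight -/

section CliqueJoin

variable {V : Type*}

/-- The graph on `V` in which `S` consists of dominating vertices, `T` is independent, and all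
vertices outside `T` form a clique. -/
def cliqueJoin (S T : Finset V) : SimpleGraph V where
  Adj u v := u ≠ v ∧ (u ∈ S ∨ v ∈ S ∨ (u ∉ T ∧ v ∉ T))
  symm := ⟨fun u v h => ⟨h.1.symm, by tauto⟩⟩
  loopless := ⟨fun _ h => h.1 rfl⟩

lemma cliqueJoin_adj {S T : Finset V} {u v : V} :
    (cliqueJoin S T).Adj u v ↔ u ≠ v ∧ (u ∈ S ∨ v ∈ S ∨ (u ∉ T ∧ v ∉ T)) := Iff.rfl

/-- Data for replacing the edges between `T` and the vertices outside `S` by edges at `w`. -/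
structure IsShift (G : SimpleGraph V) (S T : Finset V) (w : V) : Prop where
  disjoint : Disjoint S T
  notMem_left : w ∉ S
  notMem_right : w ∉ T
  indep : ∀ v ∈ T, ∀ v' ∈ T, ¬ G.Adj v v'
  unique : ∀ u ∉ S, ∀ v ∈ T, ∀ v' ∈ T, G.Adj u v → G.Adj u v' → v = v'
  ne_of_adj : ∀ u ∉ S, ∀ v ∈ T, G.Adj u v → u ≠ w
  not_adj : ∀ u ∉ S, ∀ v ∈ T, G.Adj u v → ¬ G.Adj u w

lemma IsShift.mono {G : SimpleGraph V} {S S' T : Finset V} {w : V} (h : G.IsShift S T w)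
    (hS : S ⊆ S') (hd : Disjoint S' T) (hw : w ∉ S') : G.IsShift S' T w where
  disjoint := hd
  notMem_left := hw
  notMem_right := h.notMem_right
  indep := h.indep
  unique u hu := h.unique u fun h' => hu (hS h')
  ne_of_adj u hu := h.ne_of_adj u fun h' => hu (hS h')
  not_adj u hu := h.not_adj u fun h' => hu (hS h')

lemma exists_eq_cliqueJoin_of_iso {G : SimpleGraph V} {s m t : ℕ}
    (e : G ≃g joinCompleteUnion s m t) :
    ∃ S T : Finset V, Disjoint S T ∧ S.card = s ∧ T.card = t ∧ G = cliqueJoin S T := by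
  classical
  obtain ⟨f, h1, hinj, hsurj⟩ : ∃ f : Fin s ⊕ (Fin m ⊕ Fin t) → V,
      (∀ i, e (f i) = i) ∧ Function.Injective f ∧ Function.Surjective f :=
    ⟨e.symm, e.apply_symm_apply, e.symm.injective, e.symm.surjective⟩
  have h2 : ∀ i j, f i = f j ↔ i = j := fun i j => hinj.eq_iff
  refine ⟨Finset.univ.image fun i => f (.inl i), Finset.univ.image fun i => f (.inr (.inr i)), ?_,
    ?_, ?_, ?_⟩
  · rw [Finset.disjoint_left]
    intro v h3 h4
    simp only [Finset.mem_image, Finset.mem_univ, true_and] at h3 h4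
    obtain ⟨i, rfl⟩ := h3
    obtain ⟨j, hj⟩ := h4
    cases hinj hj
  · rw [Finset.card_image_of_injective _ fun i j h => by simpa [h2] using h, Finset.card_fin]
  · rw [Finset.card_image_of_injective _ fun i j h => by simpa [h2] using h, Finset.card_fin]
  · ext u v
    rw [← e.map_adj_iff, cliqueJoin_adj]
    obtain ⟨i, rfl⟩ := hsurj u
    obtain ⟨j, rfl⟩ := hsurj v
    rw [h1, h1]
    rcases i with i | i | i <;> rcases j with j | j | j <;>
      simp [joinCompleteUnion, joinGraph, h2]

variable [Fintype V]

lemma nonempty_iso_cliqueJoin {S T : Finset V} (hST : Disjoint S T) {m : ℕ}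
    (hm : Fintype.card V = S.card + m + T.card) :
    Nonempty (cliqueJoin S T ≃g joinCompleteUnion S.card m T.card) := by
  classical
  have hU : ((S ∪ T)ᶜ).card = m := by
    rw [Finset.card_compl, Finset.card_union_of_disjoint hST]; omega
  let a := S.equivFin.symm
  let c := T.equivFin.symm
  let b := (((S ∪ T)ᶜ).equivFinOfCardEq hU).symm
  have hb : ∀ i, (b i : V) ∉ S ∧ (b i : V) ∉ T := fun i => by
    simpa using (b i).2
  have ha : ∀ i, (a i : V) ∉ T := fun i => Finset.disjoint_left.1 hST (a i).2
  have hc : ∀ i, (c i : V) ∉ S := fun i => Finset.disjoint_right.1 hST (c i).2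
  let f : Fin S.card ⊕ (Fin m ⊕ Fin T.card) → V :=
    Sum.elim (fun i => a i) (Sum.elim (fun i => b i) (fun i => c i))
  have hf : Function.Injective f := by
    rintro (i | i | i) (j | j | j) h <;> simp only [f, Sum.elim_inl, Sum.elim_inr] at h
    · rw [a.injective (Subtype.ext h)]
    · exact absurd (h ▸ (a i).2) (hb j).1
    · exact absurd (h ▸ (a i).2) (hc j)
    · exact absurd (h ▸ (a j).2) (hb i).1
    · rw [b.injective (Subtype.ext h)]
    · exact absurd (h ▸ (c j).2) (hb i).2
    · exact absurd (h ▸ (a j).2) (hc i)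
    · exact absurd (h ▸ (c i).2) (hb j).2
    · rw [c.injective (Subtype.ext h)]
  have hbij : Function.Bijective f := by
    rw [Fintype.bijective_iff_injective_and_card]
    refine ⟨hf, ?_⟩
    simp only [Fintype.card_sum, Fintype.card_fin]
    omega
  refine ⟨(⟨Equiv.ofBijective f hbij, ?_⟩ :
    joinCompleteUnion S.card m T.card ≃g cliqueJoin S T).symm⟩
  intro i j
  rw [Equiv.ofBijective_apply, Equiv.ofBijective_apply, cliqueJoin_adj, hf.ne_iff]
  rcases i with i | i | i <;> rcases j with j | j | j <;>
    simp [f, joinCompleteUnion, joinGraph, hb, hc, ha]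

lemma qForm_iso {W : Type*} [Fintype W] {G : SimpleGraph V} {H : SimpleGraph W} (e : G ≃g H)
    (y : V → ℝ) : H.qForm (y ∘ e.symm) = G.qForm y := by
  classical
  unfold qForm
  rw [← e.toEquiv.sum_comp]
  refine Finset.sum_congr rfl fun u _ => ?_
  rw [← e.toEquiv.sum_comp]
  refine Finset.sum_congr rfl fun v _ => ?_
  have h1 : ∀ i, e.symm (e i) = i := e.symm_apply_apply
  have h2 : H.Adj (e u) (e v) ↔ G.Adj u v := e.map_adj_iff
  simp [h1, h2]

lemma qForm_le_qIndex_of_iso {W : Type*} [Fintype W] {G : SimpleGraph V} {H : SimpleGraph W}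
    (e : G ≃g H) (y : V → ℝ) : G.qForm y ≤ 2 * H.qIndex * (y ⬝ᵥ y) := by
  have h := H.qForm_le_qIndex (y ∘ e.symm)
  rw [qForm_iso] at h
  convert h using 2
  simp only [dotProduct]
  rw [← e.toEquiv.sum_comp]
  have h1 : ∀ i, e.symm (e i) = i := e.symm_apply_apply
  simp [h1]

/-- Each lost edge `uv` with `v ∈ T` is paid for by the new edge `uw`, since `x v ≤ x w`; by
`unique`, no new edge pays twice. -/
lemma IsShift.qForm_le {G : SimpleGraph V} {S T : Finset V} {w : V} (h : G.IsShift S T w)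
    {x : V → ℝ} (hx : ∀ v, 0 ≤ x v) (hmax : ∀ v ∈ T, x v ≤ x w) :
    G.qForm x ≤ (cliqueJoin S T).qForm x := by
  classical
  -- `e u v` is the weight of a lost edge from `u` into `T`, and `N u` the total lost at `u`.
  let e : V → V → ℝ := fun u v =>
    if u ∉ S ∧ u ∉ T ∧ v ∈ T ∧ G.Adj u v then (x u + x v) ^ 2 else 0
  let N : V → ℝ := fun u => ∑ v, e u v
  have hN0 : ∀ u, (∀ v ∈ T, u ∉ S → u ∉ T → ¬ G.Adj u v) → N u = 0 := fun u hu =>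
    Finset.sum_eq_zero fun v _ => if_neg fun ⟨h1, h2, h3, h4⟩ => hu v h3 h1 h2 h4
  have hN1 : ∀ u, N u ≤ (x u + x w) ^ 2 := by
    intro u
    by_cases hu : ∀ v ∈ T, u ∉ S → u ∉ T → ¬ G.Adj u v
    · rw [hN0 u hu]; positivity
    · push Not at hu
      obtain ⟨v, hv, hS, hT, huv⟩ := hu
      have : N u = e u v := by
        refine Finset.sum_eq_single v (fun v' _ hne => if_neg ?_) (by simp)
        rintro ⟨-, -, h3, h4⟩
        exact hne (h.unique u hS v' h3 v hv h4 huv)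
      rw [this]
      simp only [e, if_pos (show u ∉ S ∧ u ∉ T ∧ v ∈ T ∧ G.Adj u v from ⟨hS, hT, hv, huv⟩)]
      exact pow_le_pow_left₀ (add_nonneg (hx _) (hx _)) (by linarith [hmax v hv]) 2
  have hNw : ∀ u, (u = w ∨ G.Adj u w ∨ u ∈ S ∨ u ∈ T) → N u = 0 := by
    intro u hu
    refine hN0 u fun v hv hS hT huv => ?_
    rcases hu with rfl | hu | hu | hu
    · exact h.ne_of_adj _ hS v hv huv rfl
    · exact h.not_adj u hS v hv huv hu
    · exact hS hu
    · exact hT hu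
  -- The loss `N u` is charged to the pairs `(u, w)` and `(w, u)` and recorded by `e` where it
  -- occurs. Summed over all pairs, both corrections equal `2 * ∑ u, N u` and cancel.
  have hpt : ∀ u v, (if G.Adj u v then (x u + x v) ^ 2 else 0)
        + ((if v = w then N u else 0) + (if u = w then N v else 0))
      ≤ (if (cliqueJoin S T).Adj u v then (x u + x v) ^ 2 else 0) + (e u v + e v u) := by
    have hw1 := h.notMem_left
    have hw2 := h.notMem_right
    have half : ∀ u, (if G.Adj u w then (x u + x w) ^ 2 else 0) + N u
        ≤ (if (cliqueJoin S T).Adj u w then (x u + x w) ^ 2 else 0) + (e u w + e w u) := by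
      intro u
      have he : 0 ≤ e u w + e w u := by
        simp only [e]; positivity
      by_cases hu : u = w ∨ G.Adj u w ∨ u ∈ S ∨ u ∈ T
      · rw [hNw u hu, add_zero]
        by_cases huw : G.Adj u w
        · have hJ : (cliqueJoin S T).Adj u w := by
            refine cliqueJoin_adj.2 ⟨huw.ne, ?_⟩
            by_cases hT : u ∈ T
            · exact absurd rfl (h.ne_of_adj w hw1 u hT huw.symm)
            · exact Or.inr (Or.inr ⟨hT, hw2⟩)
          rw [if_pos huw, if_pos hJ]
          linarith
        · rw [if_neg huw]
          positivity
      · push Not at hu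
        have hJ : (cliqueJoin S T).Adj u w :=
          cliqueJoin_adj.2 ⟨hu.1, Or.inr (Or.inr ⟨hu.2.2.2, hw2⟩)⟩
        rw [if_neg hu.2.1, if_pos hJ]
        linarith [hN1 u]
    intro u v
    by_cases hv : v = w
    · subst hv
      by_cases hu : u = v
      · subst hu
        simp [hNw]
        simp only [e]; positivity
      · simpa [hu] using half u
    · by_cases hu : u = w
      · subst hu
        simpa [hv, G.adj_comm u v, (cliqueJoin S T).adj_comm u v, add_comm] using half v
      · simp only [hu, hv, if_false, add_zero]
        by_cases huv : G.Adj u v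
        · by_cases hJ : (cliqueJoin S T).Adj u v
          · rw [if_pos huv, if_pos hJ]
            have : 0 ≤ e u v + e v u := by simp only [e]; positivity
            linarith
          · rw [if_pos huv, if_neg hJ, zero_add]
            have hJ' : u ∉ S ∧ v ∉ S ∧ (u ∈ T ∨ v ∈ T) := by
              rw [cliqueJoin_adj] at hJ
              have := huv.ne
              tauto
            obtain ⟨h1, h2, h3⟩ := hJ'
            have h4 := huv.symm
            rcases h3 with h3 | h3
            · have h5 : v ∉ T := fun h5 => h.indep u h3 v h5 huv
              simp [e, h1, h2, h3, h4, h5, add_comm]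
            · have h5 : u ∉ T := fun h5 => h.indep u h5 v h3 huv
              simp [e, h1, h2, h3, huv, h5]
        · rw [if_neg huv]
          simp only [e]; positivity
  have hsum := Finset.sum_le_sum fun u (_ : u ∈ Finset.univ) =>
    Finset.sum_le_sum fun v (_ : v ∈ Finset.univ) => hpt u v
  simp only [Finset.sum_add_distrib] at hsum
  have e1 : ∑ u, ∑ v, (if v = w then N u else 0) = ∑ u, N u := by simp
  have e2 : ∑ u, ∑ v, (if u = w then N v else 0) = ∑ u, N u := by
    rw [Finset.sum_comm]; simp
  have e3 : ∑ u, ∑ v, e v u = ∑ u, N u := by rw [Finset.sum_comm]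
  rw [e1, e2, e3] at hsum
  unfold qForm
  have e4 : ∑ u, ∑ v, e u v = ∑ u, N u := rfl
  linarith

/-- A neighbour gained at `u` would add a positive term to row `u`, as `x` is positive. -/
lemma eq_of_mulVec_eq_of_le {G H : SimpleGraph V} {x : V → ℝ} (hx : ∀ v, 0 < x v) {u : V}
    (h : G.signlessLapMatrix.mulVec x u = H.signlessLapMatrix.mulVec x u)
    (hle : ∀ v, G.Adj u v → H.Adj u v) (v : V) : H.Adj u v → G.Adj u v := by
  classical
  intro hv
  by_contra hG
  rw [signlessLapMatrix_mulVec_apply, signlessLapMatrix_mulVec_apply] at h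
  refine absurd h (ne_of_lt (Finset.sum_lt_sum (fun v _ => ?_) ⟨v, Finset.mem_univ _, ?_⟩))
  · split_ifs with h1 h2 h2
    · exact le_rfl
    · exact absurd (hle v h1) h2
    · exact (add_pos (hx _) (hx _)).le
    · exact le_rfl
  · rw [if_neg hG, if_pos hv]
    exact add_pos (hx _) (hx _)

/-- Row `w` comes first: it makes `w` adjacent in `G` to every other vertex outside `T`. By
`not_adj`, no edge between `T` and the complement of `S` survives, so `G` lies inside `cliqueJoin S
T` and every row can be compared. -/
lemma IsShift.eq_cliqueJoin {G : SimpleGraph V} {S T : Finset V} {w : V} (h : G.IsShift S T w)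
    {x : V → ℝ} (hx : ∀ v, 0 < x v)
    (heq : G.signlessLapMatrix.mulVec x = (cliqueJoin S T).signlessLapMatrix.mulVec x) :
    G = cliqueJoin S T := by
  have hw : ∀ v, (cliqueJoin S T).Adj w v → G.Adj w v := by
    refine eq_of_mulVec_eq_of_le hx (congrFun heq w) fun v hv => cliqueJoin_adj.2 ⟨hv.ne, ?_⟩
    refine Or.inr (Or.inr ⟨h.notMem_right, fun hT => ?_⟩)
    exact h.ne_of_adj w h.notMem_left v hT hv rfl
  have key : ∀ u v, G.Adj u v → u ∉ S → v ∉ T := by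
    intro u v huv hS hT
    have huT : u ∉ T := fun hu => h.indep u hu v hT huv
    have hne := h.ne_of_adj u hS v hT huv
    exact h.not_adj u hS v hT huv
      (hw u (cliqueJoin_adj.2 ⟨hne.symm, Or.inr (Or.inr ⟨h.notMem_right, huT⟩)⟩)).symm
  have hle : ∀ u v, G.Adj u v → (cliqueJoin S T).Adj u v := by
    intro u v huv
    refine cliqueJoin_adj.2 ⟨huv.ne, ?_⟩
    have h1 := key u v huv
    have h2 := key v u huv.symm
    tauto
  ext u v
  exact ⟨hle u v, eq_of_mulVec_eq_of_le hx (congrFun heq u) (hle u) v⟩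

end CliqueJoin

/-! ### Positivity of the characteristic polynomial -/

/-- The characteristic polynomial, up to sign and the trivial factors, of the signless Laplacian of
`K_k ∨ (K_{n-k-t} ∪ t K_1)`, with real parameters. -/
def joinPoly (n k t q : ℝ) : ℝ :=
  (q - 2 * (n - t - 1)) * (q - 2 * (n - t - 1) + n - t) * (q - k)
    - t * q * (q - 2 * (n - t - 1) + k)

/-- Increasing the number of dominating vertices from `s` to `s + 1` and the number of isolated
vertices from `L` to `b * (s + 1)` makes `joinPoly` positive. -/
lemma joinPoly_succ_pos {b s L n q : ℝ} (hb : 2 ≤ b) (hs : 0 ≤ s) (hL0 : 0 ≤ L)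
    (hL : L + 1 ≤ b * (s + 1)) (hn1 : 6 * L ≤ n) (hn2 : 3 * (b * (s + 1)) ≤ n)
    (hn3 : 6 * b ≤ n) (hq1 : q ≤ 2 * n - 2) (hq2 : 2 * (n - L - 1) ≤ q)
    (h : 0 ≤ joinPoly n s L q) : 0 < joinPoly n (s + 1) (b * (s + 1)) q := by
  set t := b * (s + 1) with ht
  have hk : 6 * (s + 1) ≤ n := by nlinarith
  obtain ⟨k, hkdef⟩ : ∃ k, k = s + 1 := ⟨_, rfl⟩
  rw [← hkdef] at hk ⊢
  have hk0 : 1 ≤ k := by linarith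
  have hn12 : 12 ≤ n := by linarith
  have hqn : 3 / 2 * n ≤ q := by linarith
  have hA : 2 / 3 * n ≤ q + 2 - n := by linarith
  set D := q + 2 - 2 * n with hD
  -- The passage goes from `(s, L)` to `(k, L)` to `(k, t)`. The first move loses at most `11/18 *
  -- (n * q)`; the second gains at least `13/18 * (n * q)`, because `t - L ≥ 1`.
  have key1 : joinPoly n k t q - joinPoly n k L q
      = (t - L) * (2 * (q + 2 - n) * q - 2 * (q + 2 - n) * k - k * D - k * q
        - 2 * k * (t + L)) := by
    simp only [joinPoly, hD]; ring
  have key2 : joinPoly n k L q - joinPoly n s L q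
      = -((D + 2 * L) * (D + L + n) + L * q) := by
    simp only [joinPoly, hD, hkdef]; ring
  have hbound1 : 13 / 18 * (n * q) ≤ 2 * (q + 2 - n) * q - 2 * (q + 2 - n) * k - k * D - k * q
        - 2 * k * (t + L) := by
    have e1 : 4 / 3 * n * q ≤ 2 * (q + 2 - n) * q := by nlinarith
    have e2 : k * (2 * (q + 2 - n) + D + q + 2 * (t + L)) ≤ n / 6 * (3 * q + n) := by
      apply mul_le_mul (by linarith) _ _ (by linarith)
      · linarith
      · nlinarith
    nlinarith
  have hbound2 : (D + 2 * L) * (D + L + n) + L * q ≤ 11 / 18 * (n * q) := by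
    have e1 : (D + 2 * L) * (D + L + n) ≤ (n / 3) * (7 / 6 * n) := by
      apply mul_le_mul (by linarith) (by linarith) (by linarith) (by linarith)
    have e2 : L * q ≤ n / 6 * q := mul_le_mul_of_nonneg_right (by linarith) (by linarith)
    nlinarith
  have hnq : 0 < n * q := by apply mul_pos <;> linarith
  have hfin : 13 / 18 * (n * q) ≤ joinPoly n k t q - joinPoly n k L q := by
    rw [key1]
    nlinarith
  linarith

/-- At `k = n / (b + 1)` no vertices remain outside `S` and `T`, so the polynomial factors; the
second factor is the quadratic belonging to `K_k ∨ (bk) K_1`. -/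
lemma joinPoly_end_pos {b L n q : ℝ} (hb : 2 ≤ b) (hn1 : 6 * L ≤ n)
    (hn3 : 6 * b ≤ n) (hq2 : 2 * (n - L - 1) ≤ q) :
    0 < joinPoly n (n / (b + 1)) (b * (n / (b + 1))) q := by
  obtain ⟨k, hk⟩ : ∃ k, k = n / (b + 1) := ⟨_, rfl⟩
  rw [← hk]
  have hn : n = (b + 1) * k := by rw [hk]; field_simp
  have hk1 : 1 < k := by
    rw [hk, lt_div_iff₀ (by linarith)]; linarith
  have h3k : 3 * k ≤ n := by rw [hn]; nlinarith
  have hq0 : 0 < q := by linarith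
  have e : joinPoly n k (b * k) q
      = (q - 2 * (n - b * k - 1) + k) * (q * (q + 2 - 2 * k - n) + 2 * k * (k - 1)) := by
    simp only [joinPoly, hn]; ring
  rw [e]
  apply mul_pos
  · have : n - b * k = k := by rw [hn]; ring
    linarith
  · have h1 : 0 ≤ q * (q + 2 - 2 * k - n) := mul_nonneg hq0.le (by linarith)
    have h2 : 0 < 2 * k * (k - 1) := by apply mul_pos <;> linarith
    linarith

/-- Along `t = b * k` the polynomial is concave in `k`, so that positivity at `s + 1` and at
`n / (b + 1)` gives positivity in between. -/
lemma joinPoly_mul_pos {b s L n q k : ℝ} (hb : 2 ≤ b) (hs : 0 ≤ s) (hL0 : 0 ≤ L)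
    (hL : L + 1 ≤ b * (s + 1)) (hn1 : 6 * L ≤ n) (hn2 : 3 * (b * (s + 1)) ≤ n)
    (hn3 : 6 * b ≤ n) (hq1 : q ≤ 2 * n - 2) (hq2 : 2 * (n - L - 1) ≤ q)
    (h : 0 ≤ joinPoly n s L q) (hk1 : s + 1 ≤ k) (hk2 : (b + 1) * k < n) :
    0 < joinPoly n k (b * k) q := by
  have h0 := joinPoly_succ_pos hb hs hL0 hL hn1 hn2 hn3 hq1 hq2 h
  have h1 := joinPoly_end_pos hb hn1 hn3 hq2
  have hk2' : k < n / (b + 1) := by rw [lt_div_iff₀ (by linarith)]; linarith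
  generalize n / (b + 1) = k₁ at h1 hk2'
  -- Linear interpolation between `s + 1` and `k₁` with its remainder; the last factor is minus the
  -- second divided difference of a cubic in `k`.
  have hid : joinPoly n k (b * k) q * (k₁ - (s + 1))
      = (k₁ - k) * joinPoly n (s + 1) (b * (s + 1)) q
        + (k - (s + 1)) * joinPoly n k₁ (b * k₁) q
        + (k - (s + 1)) * (k₁ - k) * (k₁ - (s + 1))
          * (2 * b ^ 2 * (k + (s + 1) + k₁) + b * (4 * q + 6 - 4 * n)) := by
    simp only [joinPoly]; ring
  have hpos : 0 < joinPoly n k (b * k) q * (k₁ - (s + 1)) := by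
    rw [hid]
    have a1 : 0 < (k₁ - k) * joinPoly n (s + 1) (b * (s + 1)) q := mul_pos (by linarith) h0
    have a2 : 0 ≤ (k - (s + 1)) * joinPoly n k₁ (b * k₁) q := mul_nonneg (by linarith) h1.le
    have a3 : 0 ≤ (k - (s + 1)) * (k₁ - k) * (k₁ - (s + 1)) :=
      mul_nonneg (mul_nonneg (by linarith) (by linarith)) (by linarith)
    have a4 : 0 ≤ 2 * b ^ 2 * (k + (s + 1) + k₁) + b * (4 * q + 6 - 4 * n) := by
      have : 0 ≤ 4 * q + 6 - 4 * n := by linarith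
      have : 0 ≤ k + (s + 1) + k₁ := by linarith
      positivity
    have := mul_nonneg a3 a4
    linarith
  exact pos_of_mul_pos_left hpos (by linarith)

/-! ### Test vectors constant on the blocks of `cliqueJoin S T` -/

section JoinRayleigh

variable {V : Type*} [Fintype V]

/-- A positive vector bounds the quadratic form of the signless Laplacian. -/
lemma qForm_le_sum_div (G : SimpleGraph V) {y : V → ℝ} (hy : ∀ v, 0 < y v) (x : V → ℝ) :
    G.qForm x ≤ 2 * ∑ u, x u ^ 2 * (G.signlessLapMatrix.mulVec y u / y u) := by
  classical
  have h1 : ∑ u, x u ^ 2 * (G.signlessLapMatrix.mulVec y u / y u)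
      = ∑ u, ∑ v, if G.Adj u v then x u ^ 2 * ((y u + y v) / y u) else 0 := by
    refine Finset.sum_congr rfl fun u _ => ?_
    rw [signlessLapMatrix_mulVec_apply, Finset.sum_div, Finset.mul_sum]
    refine Finset.sum_congr rfl fun v _ => ?_
    split_ifs <;> simp
  have h2 : ∑ u, x u ^ 2 * (G.signlessLapMatrix.mulVec y u / y u)
      = ∑ u, ∑ v, if G.Adj u v then x v ^ 2 * ((y u + y v) / y v) else 0 := by
    rw [h1, Finset.sum_comm]
    refine Finset.sum_congr rfl fun u _ => Finset.sum_congr rfl fun v _ => ?_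
    rw [G.adj_comm, add_comm (y v)]
  rw [two_mul]
  nth_rw 1 [h1]
  rw [h2, qForm, ← Finset.sum_add_distrib]
  refine Finset.sum_le_sum fun u _ => ?_
  rw [← Finset.sum_add_distrib]
  refine Finset.sum_le_sum fun v _ => ?_
  split_ifs
  · have hu := hy u
    have hv := hy v
    have : x u ^ 2 * ((y u + y v) / y u) + x v ^ 2 * ((y u + y v) / y v) - (x u + x v) ^ 2
        = (x u * y v - x v * y u) ^ 2 / (y u * y v) := by
      field_simp; ring
    have h0 : 0 ≤ (x u * y v - x v * y u) ^ 2 / (y u * y v) := by positivity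
    linarith
  · simp

open Classical in
/-- The vector with value `α` on `S`, `γ` on `T` and `β` elsewhere. -/
noncomputable def blockVec (S T : Finset V) (α β γ : ℝ) (v : V) : ℝ :=
  if v ∈ S then α else if v ∈ T then γ else β

variable {S T : Finset V}

lemma sum_blockVec (hST : Disjoint S T) (α β γ : ℝ) :
    ∑ v, blockVec S T α β γ v
      = S.card * α + ((Fintype.card V : ℝ) - S.card - T.card) * β + T.card * γ := by
  classical
  have h : ∀ v, blockVec S T α β γ v
      = (if v ∈ S then α - β else 0) + (if v ∈ T then γ - β else 0) + β := by
    intro v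
    unfold blockVec
    by_cases hS : v ∈ S
    · have hT := Finset.disjoint_left.1 hST hS
      simp [hS, hT]
    · by_cases hT : v ∈ T <;> simp [hS, hT]
  simp only [h, Finset.sum_add_distrib, Finset.sum_ite_mem, Finset.univ_inter, Finset.sum_const,
    Finset.card_univ, nsmul_eq_mul]
  ring

lemma cliqueJoin_mulVec_blockVec (hST : Disjoint S T) (β γ : ℝ) :
    (cliqueJoin S T).signlessLapMatrix.mulVec (blockVec S T 1 β γ)
      = blockVec S T
        ((Fintype.card V : ℝ) - 2 + S.card
          + ((Fintype.card V : ℝ) - S.card - T.card) * β + T.card * γ)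
        (((Fintype.card V : ℝ) - T.card - 2) * β + S.card
          + ((Fintype.card V : ℝ) - S.card - T.card) * β)
        (S.card * (1 + γ)) := by
  classical
  funext u
  rw [signlessLapMatrix_mulVec_apply]
  have hd : ∀ v, v ∈ S → v ∉ T := fun v => fun h => Finset.disjoint_left.1 hST h
  by_cases hS : u ∈ S
  · have h : ∀ v, (if (cliqueJoin S T).Adj u v then blockVec S T 1 β γ u + blockVec S T 1 β γ v
        else 0) = blockVec S T 2 (1 + β) (1 + γ) v - if u = v then 2 else 0 := by
      intro v
      by_cases huv : u = v
      · subst huv; simp [blockVec, hS]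
      · by_cases h1 : v ∈ S <;> by_cases h2 : v ∈ T <;>
          simp [cliqueJoin_adj, blockVec, hS, huv, h1, h2]
        norm_num
        norm_num
    simp only [h, Finset.sum_sub_distrib, sum_blockVec hST, Finset.sum_ite_eq, Finset.mem_univ,
      if_true]
    simp only [blockVec, hS, if_true]
    ring
  · by_cases hT : u ∈ T
    · have h : ∀ v, (if (cliqueJoin S T).Adj u v then blockVec S T 1 β γ u + blockVec S T 1 β γ v
          else 0) = blockVec S T (1 + γ) 0 0 v := by
        intro v
        by_cases huv : u = v
        · subst huv; simp [blockVec, hS, hT]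
        · by_cases h1 : v ∈ S <;> by_cases h2 : v ∈ T <;>
            simp [cliqueJoin_adj, blockVec, hS, hT, huv, h1, h2, add_comm]
      simp only [h, sum_blockVec hST]
      simp only [blockVec, hS, hT, if_true, if_false]
      ring
    · have h : ∀ v, (if (cliqueJoin S T).Adj u v then blockVec S T 1 β γ u + blockVec S T 1 β γ v
          else 0) = blockVec S T (1 + β) (2 * β) 0 v - if u = v then 2 * β else 0 := by
        intro v
        by_cases huv : u = v
        · subst huv; simp [blockVec, hS, hT]
        · by_cases h1 : v ∈ S <;> by_cases h2 : v ∈ T <;>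
            simp [cliqueJoin_adj, blockVec, hS, hT, huv, h1, h2, add_comm, two_mul]
      simp only [h, Finset.sum_sub_distrib, sum_blockVec hST, Finset.sum_ite_eq, Finset.mem_univ,
        if_true]
      simp only [blockVec, hS, hT, if_false]
      ring

lemma blockVec_dotProduct (α β γ α' β' γ' : ℝ) (hST : Disjoint S T) :
    blockVec S T α β γ ⬝ᵥ blockVec S T α' β' γ'
      = S.card * (α * α') + ((Fintype.card V : ℝ) - S.card - T.card) * (β * β')
        + T.card * (γ * γ') := by
  rw [← sum_blockVec hST]
  refine Finset.sum_congr rfl fun v _ => ?_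
  unfold blockVec
  split_ifs <;> rfl

lemma qForm_blockVec (hST : Disjoint S T) (β γ : ℝ) :
    (cliqueJoin S T).qForm (blockVec S T 1 β γ)
      = 2 * (S.card * ((Fintype.card V : ℝ) - 2 + S.card
          + ((Fintype.card V : ℝ) - S.card - T.card) * β + T.card * γ)
        + ((Fintype.card V : ℝ) - S.card - T.card)
          * (β * (((Fintype.card V : ℝ) - T.card - 2) * β + S.card
            + ((Fintype.card V : ℝ) - S.card - T.card) * β))
        + T.card * (γ * (S.card * (1 + γ)))) := by
  rw [qForm_eq_dotProduct, cliqueJoin_mulVec_blockVec hST, blockVec_dotProduct _ _ _ _ _ _ hST,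
    one_mul]

/-- The test vector is the indicator of the complement of `T`, which is a clique on `n - |T|`
vertices. -/
lemma le_of_qForm_cliqueJoin_le (hST : Disjoint S T) {q : ℝ} (hT : T.card < Fintype.card V)
    (h : ∀ y, (cliqueJoin S T).qForm y ≤ 2 * q * (y ⬝ᵥ y)) :
    2 * ((Fintype.card V : ℝ) - T.card - 1) ≤ q := by
  have h1 := h (blockVec S T 1 1 0)
  rw [qForm_blockVec hST, blockVec_dotProduct _ _ _ _ _ _ hST] at h1
  have hT' : (T.card : ℝ) < Fintype.card V := by exact_mod_cast hT
  have h2 : 0 ≤ (S.card : ℝ) * T.card := by positivity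
  by_contra! hcon
  nlinarith [mul_pos (sub_pos.2 hcon) (sub_pos.2 hT')]

/-- The test vector solves the eigenvalue equation for `q` off `S`, so its Rayleigh quotient bounds
the row on `S` by `q`; clearing positive denominators turns this bound into `joinPoly`. -/
lemma joinPoly_nonneg_of_qForm_cliqueJoin_le (hST : Disjoint S T) {q : ℝ}
    (hT : 2 * T.card ≤ Fintype.card V) (hT' : T.card < Fintype.card V) (hq : S.card < q)
    (h : ∀ y, (cliqueJoin S T).qForm y ≤ 2 * q * (y ⬝ᵥ y)) :
    0 ≤ joinPoly (Fintype.card V) S.card T.card q := by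
  have hz := le_of_qForm_cliqueJoin_le hST hT' h
  have hT2 : 2 * (T.card : ℝ) ≤ Fintype.card V := by exact_mod_cast hT
  rcases S.card.eq_zero_or_pos with h0 | h0
  -- For empty `S` that vector vanishes, but `joinPoly` factors, with signs known from `2 * |T| ≤
  -- n`.
  · rw [h0] at hq ⊢
    have e : joinPoly (Fintype.card V) ((0 : ℕ) : ℝ) T.card q
        = q * ((q - 2 * ((Fintype.card V : ℝ) - T.card - 1))
          * (q - 2 * ((Fintype.card V : ℝ) - T.card - 1)
            + (Fintype.card V - 2 * T.card))) := by
      simp only [joinPoly]; push_cast; ring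
    rw [e]
    have hq0 : 0 < q := by exact_mod_cast hq
    exact mul_nonneg hq0.le (mul_nonneg (by linarith) (by linarith))
  · have hk : (0 : ℝ) < S.card := by exact_mod_cast h0
    have h1 := h (blockVec S T 1 (S.card / (q - 2 * ((Fintype.card V : ℝ) - T.card - 1) + S.card))
      (S.card / (q - S.card)))
    rw [qForm_blockVec hST, blockVec_dotProduct _ _ _ _ _ _ hST] at h1
    generalize (S.card : ℝ) = k at *
    generalize (T.card : ℝ) = t at *
    generalize (Fintype.card V : ℝ) = n at *
    have hd1 : 0 < q - 2 * (n - t - 1) + k := by linarith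
    have hd2 : 0 < q - k := by linarith
    have e : joinPoly n k t q = (q - 2 * (n - t - 1) + k) * (q - k)
        * (q - (n - 2 + k + (n - k - t) * (k / (q - 2 * (n - t - 1) + k)) + t * (k / (q - k)))) := by
      simp only [joinPoly]; field_simp; ring
    have e1 : (n - t - 2) * (k / (q - 2 * (n - t - 1) + k)) + k
        + (n - k - t) * (k / (q - 2 * (n - t - 1) + k)) = q * (k / (q - 2 * (n - t - 1) + k)) := by
      field_simp; ring
    have e2 : k * (1 + k / (q - k)) = q * (k / (q - k)) := by field_simp; ring
    rw [e1, e2] at h1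
    rw [e]
    refine mul_nonneg (mul_pos hd1 hd2).le ?_
    by_contra! hcon
    nlinarith [mul_pos hk (neg_pos.2 hcon)]

/-- The converse use of the same vector `y`: `Qy = qy` off `S`, and `joinPoly > 0` means `Qy < qy`
on `S`. The bound `qForm_le_sum_div` is then strict, because `x` is positive on the nonempty set
`S`. -/
lemma qForm_cliqueJoin_lt (hST : Disjoint S T) {q : ℝ} (hS : S.Nonempty)
    (hz : 2 * ((Fintype.card V : ℝ) - T.card - 1) < q) (hq : S.card < q)
    (hP : 0 < joinPoly (Fintype.card V) S.card T.card q) {x : V → ℝ} (hx : ∀ v, 0 < x v) :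
    (cliqueJoin S T).qForm x < 2 * q * (x ⬝ᵥ x) := by
  classical
  have hk : (0 : ℝ) < S.card := by exact_mod_cast hS.card_pos
  set β := (S.card : ℝ) / (q - 2 * ((Fintype.card V : ℝ) - T.card - 1) + S.card) with hβ
  set γ := (S.card : ℝ) / (q - S.card) with hγ
  have hd1 : 0 < q - 2 * ((Fintype.card V : ℝ) - T.card - 1) + S.card := by linarith
  have hd2 : 0 < q - S.card := by linarith
  have hβ0 : 0 < β := div_pos hk hd1
  have hγ0 : 0 < γ := div_pos hk hd2
  have hy : ∀ v, 0 < blockVec S T 1 β γ v := fun v => by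
    unfold blockVec; split_ifs <;> linarith
  have hlt : (Fintype.card V : ℝ) - 2 + S.card
      + ((Fintype.card V : ℝ) - S.card - T.card) * β + T.card * γ < q := by
    rw [hβ, hγ]
    clear_value β γ
    generalize (S.card : ℝ) = k at *
    generalize (T.card : ℝ) = t at *
    generalize (Fintype.card V : ℝ) = n at *
    have e : joinPoly n k t q = (q - 2 * (n - t - 1) + k) * (q - k)
        * (q - (n - 2 + k + (n - k - t) * (k / (q - 2 * (n - t - 1) + k)) + t * (k / (q - k)))) := by
      simp only [joinPoly]; field_simp; ring
    rw [e] at hP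
    have := pos_of_mul_pos_right hP (mul_pos hd1 hd2).le
    linarith
  have e1 : ((Fintype.card V : ℝ) - T.card - 2) * β + S.card
      + ((Fintype.card V : ℝ) - S.card - T.card) * β = q * β := by
    rw [hβ]; field_simp; ring
  have e2 : S.card * (1 + γ) = q * γ := by rw [hγ]; field_simp; ring
  refine lt_of_le_of_lt (qForm_le_sum_div _ hy x) ?_
  rw [mul_assoc]
  refine mul_lt_mul_of_pos_left ?_ two_pos
  rw [dotProduct, Finset.mul_sum, cliqueJoin_mulVec_blockVec hST, e1, e2]
  have hrow : ∀ u, u ∉ S → blockVec S T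
      ((Fintype.card V : ℝ) - 2 + S.card
      + ((Fintype.card V : ℝ) - S.card - T.card) * β + T.card * γ) (q * β) (q * γ) u
      / blockVec S T 1 β γ u = q := by
    intro u hu
    unfold blockVec
    split_ifs
    · rw [mul_div_assoc, div_self hγ0.ne', mul_one]
    · rw [mul_div_assoc, div_self hβ0.ne', mul_one]
  have hrow' : ∀ u, u ∈ S → blockVec S T
      ((Fintype.card V : ℝ) - 2 + S.card
      + ((Fintype.card V : ℝ) - S.card - T.card) * β + T.card * γ) (q * β) (q * γ) u
      / blockVec S T 1 β γ u < q := by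
    intro u hu
    simp only [blockVec, hu, if_true, div_one]
    exact hlt
  obtain ⟨u₀, hu₀⟩ := hS
  refine Finset.sum_lt_sum (fun u _ => ?_) ⟨u₀, Finset.mem_univ _, ?_⟩
  · by_cases hu : u ∈ S
    · nlinarith [hrow' u hu, hx u, mul_pos (hx u) (hx u)]
    · rw [hrow u hu]; exact le_of_eq (by ring)
  · nlinarith [hrow' u₀ hu₀, mul_pos (hx u₀) (hx u₀)]

end JoinRayleigh

/-! ### From components of `G - S` to the index -/

section Toughness

variable {V : Type*} [Fintype V]

/-- One component beyond `t` is needed, since the component of the maximising vertex `w` supplies no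
representative. -/
lemma exists_isShift (G : SimpleGraph V) (S : Finset V) {t : ℕ}
    (ht : t + 1 ≤ G.numComponentsDelete S) (x : V → ℝ) :
    ∃ (T : Finset V) (w : V), T.card = t ∧ G.IsShift S T w ∧ ∀ v ∈ T, x v ≤ x w := by
  classical
  let H := G.induce ((S : Set V)ᶜ)
  have hfin : Fintype H.ConnectedComponent := Fintype.ofFinite _
  have hcard : t + 1 ≤ Fintype.card H.ConnectedComponent := by
    rw [← Nat.card_eq_fintype_card]; exact ht
  let r : H.ConnectedComponent → ((S : Set V)ᶜ : Set V) := Quot.out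
  have hr : ∀ c, H.connectedComponentMk (r c) = c := fun c => Quot.out_eq c
  have hrS : ∀ c, (r c : V) ∉ S := fun c h => (r c).2 (Finset.mem_coe.2 h)
  have hne : Nonempty ((S : Set V)ᶜ : Set V) :=
    ⟨r (Fintype.card_pos_iff.1 (by omega : 0 < Fintype.card H.ConnectedComponent)).some⟩
  obtain ⟨w, hw⟩ := Finite.exists_max fun v : ((S : Set V)ᶜ : Set V) => x v
  obtain ⟨A, hA, hAt⟩ := Finset.exists_subset_card_eq
    (s := Finset.univ.erase (H.connectedComponentMk w)) (n := t) (by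
      rw [Finset.card_erase_of_mem (Finset.mem_univ _), Finset.card_univ]; omega)
  have hAw : ∀ c ∈ A, c ≠ H.connectedComponentMk w := fun c hc => Finset.ne_of_mem_erase (hA hc)
  have hadj : ∀ u (hu : u ∈ ((S : Set V)ᶜ : Set V)) c, G.Adj u (r c) →
      H.connectedComponentMk ⟨u, hu⟩ = c := by
    intro u hu c h
    rw [← hr c]
    exact ConnectedComponent.connectedComponentMk_eq_of_adj (G := H) (v := ⟨u, hu⟩) (w := r c) h
  have hmem : ∀ v, v ∈ A.image (fun c => (r c : V)) → ∃ c ∈ A, v = r c := by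
    intro v hv
    obtain ⟨c, hc, rfl⟩ := Finset.mem_image.1 hv
    exact ⟨c, hc, rfl⟩
  refine ⟨A.image fun c => (r c : V), w, ?_, ⟨?_, ?_, ?_, ?_, ?_, ?_, ?_⟩, ?_⟩
  · rw [Finset.card_image_of_injective _ fun c d h => ?_, hAt]
    rw [← hr c, ← hr d, Subtype.ext h]
  · rw [Finset.disjoint_right]
    intro v hv
    obtain ⟨c, -, rfl⟩ := hmem v hv
    exact hrS c
  · exact fun h => w.2 (Finset.mem_coe.2 h)
  · intro hv
    obtain ⟨c, hc, h⟩ := hmem _ hv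
    exact hAw c hc (by rw [← hr c, Subtype.ext h])
  · intro v hv v' hv' h
    obtain ⟨c, hc, rfl⟩ := hmem _ hv
    obtain ⟨d, hd, rfl⟩ := hmem _ hv'
    have := hadj _ (r c).2 d h
    rw [Subtype.coe_eta, hr] at this
    rw [this] at h
    exact G.irrefl h
  · intro u hu v hv v' hv' h h'
    obtain ⟨c, hc, rfl⟩ := hmem _ hv
    obtain ⟨d, hd, rfl⟩ := hmem _ hv'
    have hu' : u ∈ ((S : Set V)ᶜ : Set V) := by simpa using hu
    rw [← hadj u hu' c h, hadj u hu' d h']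
  · rintro u hu v hv h rfl
    obtain ⟨c, hc, rfl⟩ := hmem _ hv
    exact hAw c hc (hadj _ w.2 c h).symm
  · intro u hu v hv h h'
    obtain ⟨c, hc, rfl⟩ := hmem _ hv
    have hu' : u ∈ ((S : Set V)ᶜ : Set V) := by simpa using hu
    refine hAw c hc ?_
    rw [← hadj u hu' c h]
    exact ConnectedComponent.connectedComponentMk_eq_of_adj (G := H) (v := ⟨u, hu'⟩) (w := w) h'
  · intro v hv
    obtain ⟨c, hc, rfl⟩ := hmem _ hv
    exact hw (r c)

/-- One vertex per component is an independent set. Hence no `S` qualifies when the toughness is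
infinite by convention. -/
lemma numComponentsDelete_le_indepNum (G : SimpleGraph V) (S : Finset V) :
    G.numComponentsDelete S ≤ G.indepNum := by
  classical
  rcases h : G.numComponentsDelete S with _ | t
  · exact Nat.zero_le _
  · obtain ⟨T, w, hT, hs, -⟩ := G.exists_isShift S h.ge 0
    rw [← hT, ← Finset.card_insert_of_notMem hs.notMem_right]
    refine IsIndepSet.card_le_indepNum ?_
    have hw : ∀ v ∈ T, ¬ G.Adj w v := fun v hv h' => hs.ne_of_adj w hs.notMem_left v hv h' rfl
    intro u hu v hv _ huv
    simp only [Finset.coe_insert, Set.mem_insert_iff, Finset.mem_coe] at hu hv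
    rcases hu with rfl | hu <;> rcases hv with rfl | hv
    · exact G.irrefl huv
    · exact hw v hv huv
    · exact hw u hu huv.symm
    · exact hs.indep u hu v hv huv

lemma one_div_le_div_iff_natCast {b k c : ℕ} (hb : b ≠ 0) (hc : c ≠ 0) :
    1 / (b : ℝ≥0∞) ≤ (k : ℝ≥0∞) / c ↔ c ≤ b * k := by
  rw [ENNReal.le_div_iff_mul_le (Or.inl (by exact_mod_cast hc)) (Or.inl (ENNReal.natCast_ne_top c)),
    mul_comm, mul_one_div,
    ENNReal.div_le_iff (by exact_mod_cast hb) (ENNReal.natCast_ne_top b), mul_comm]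
  exact_mod_cast Iff.rfl

lemma one_div_le_lToughness_iff (G : SimpleGraph V) {b l : ℕ} (hb : b ≠ 0) (hl : l ≠ 0) :
    1 / (b : ℝ≥0∞) ≤ G.lToughness l ↔
      ∀ S : Finset V, l ≤ G.numComponentsDelete S → G.numComponentsDelete S ≤ b * S.card := by
  unfold lToughness
  split_ifs with h
  · simp only [le_iInf_iff]
    refine forall_congr' fun S => forall_congr' fun hS => ?_
    exact one_div_le_div_iff_natCast hb (by omega)
  · simp only [le_top, true_iff]
    exact fun S hS => absurd (hS.trans (G.numComponentsDelete_le_indepNum S)) h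

/-- Deleting `S` isolates every vertex of `T`, and a vertex outside both sets gives one more
component. -/
lemma card_lt_numComponentsDelete_cliqueJoin {S T : Finset V} (hST : Disjoint S T)
    (h : S.card + T.card < Fintype.card V) :
    T.card < (cliqueJoin S T).numComponentsDelete S := by
  classical
  obtain ⟨w, hw⟩ : ∃ w, w ∉ S ∪ T := by
    by_contra! hcon
    have h1 : S ∪ T = Finset.univ := Finset.eq_univ_of_forall hcon
    have h2 := Finset.card_union_of_disjoint hST
    rw [h1, Finset.card_univ] at h2
    omega
  rw [Finset.mem_union, not_or] at hw
  have hI : ∀ v ∈ insert w T, v ∈ ((S : Set V)ᶜ : Set V) := by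
    intro v hv
    rcases Finset.mem_insert.1 hv with rfl | hv
    · simpa using hw.1
    · simpa using Finset.disjoint_right.1 hST hv
  have hiso : ∀ u v : ((S : Set V)ᶜ : Set V), (u : V) ∈ T →
      ((cliqueJoin S T).induce ((S : Set V)ᶜ)).Reachable u v → u = v := by
    rintro u v hu ⟨p⟩
    cases p with
    | nil => rfl
    | @cons _ u' _ hadj _ =>
      have h1 : (u : V) ∉ S := u.2
      have h2 : (u' : V) ∉ S := u'.2
      have h3 : (cliqueJoin S T).Adj u u' := hadj
      rw [cliqueJoin_adj] at h3
      tauto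
  let f : ↥(insert w T) → ((cliqueJoin S T).induce ((S : Set V)ᶜ)).ConnectedComponent :=
    fun v => connectedComponentMk _ ⟨v, hI v v.2⟩
  have hf : Function.Injective f := by
    intro u v huv
    have hr := ConnectedComponent.exact huv
    have hu := Finset.mem_insert.1 u.2
    have hv := Finset.mem_insert.1 v.2
    rcases hu with hu | hu
    · rcases hv with hv | hv
      · exact Subtype.ext (hu.trans hv.symm)
      · exact (Subtype.ext (congrArg (fun a => a.1) (hiso _ _ hv hr.symm))).symm
    · exact Subtype.ext (congrArg (fun a => a.1) (hiso _ _ hu hr))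
  have := Nat.card_le_card_of_injective f hf
  rw [Nat.card_eq_fintype_card, Fintype.card_coe, Finset.card_insert_of_notMem hw.2] at this
  exact this

/-- If some `S` with at most `s` vertices leaves more than `t` components, and the `Q`-index is at
least that of `K_s ∨ (K_m ∪ t K_1)`, then the graph is isomorphic to the latter. -/
lemma Connected.nonempty_iso_of_qIndex_le {G : SimpleGraph V} (hG : G.Connected) {S : Finset V}
    {s m t : ℕ} (hS : S.card ≤ s) (hc : t + 1 ≤ G.numComponentsDelete S) (hm : m ≠ 0)
    (hcard : Fintype.card V = s + m + t) (hq : (joinCompleteUnion s m t).qIndex ≤ G.qIndex) :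
    Nonempty (G ≃g joinCompleteUnion s m t) := by
  classical
  obtain ⟨x, hx, hQ⟩ := hG.exists_pos_eigenvector_qIndex
  obtain ⟨T, w, rfl, hs, hmax⟩ := G.exists_isShift S hc x
  have hsub : S ⊆ (insert w T)ᶜ := by
    intro v hv
    rw [Finset.mem_compl, Finset.mem_insert, not_or]
    exact ⟨fun h => hs.notMem_left (h ▸ hv), Finset.disjoint_left.1 hs.disjoint hv⟩
  -- Room to enlarge `S` while avoiding `T` and `w` exists because `m ≠ 0`.
  obtain ⟨S', hSS', hS', rfl⟩ := Finset.exists_subsuperset_card_eq hsub hS (by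
    rw [Finset.card_compl, Finset.card_insert_of_notMem hs.notMem_right]; omega)
  have hdisj : Disjoint S' T := by
    rw [Finset.disjoint_left]
    intro v hv hT
    exact Finset.mem_compl.1 (hS' hv) (Finset.mem_insert_of_mem hT)
  have hs' := hs.mono hSS' hdisj fun h =>
    Finset.mem_compl.1 (hS' h) (Finset.mem_insert_self _ _)
  obtain ⟨e⟩ := nonempty_iso_cliqueJoin hdisj hcard
  have h1 := hs'.qForm_le (fun v => (hx v).le) hmax
  rw [qForm_eq_of_mulVec_eq hQ] at h1
  have hxx : 0 ≤ x ⬝ᵥ x := Finset.sum_nonneg fun v _ => mul_self_nonneg _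
  have h2 : ∀ y, (cliqueJoin S' T).qForm y ≤ 2 * G.qIndex * (y ⬝ᵥ y) := fun y => by
    have hyy : 0 ≤ y ⬝ᵥ y := Finset.sum_nonneg fun v _ => mul_self_nonneg _
    refine (qForm_le_qIndex_of_iso e y).trans ?_
    exact mul_le_mul_of_nonneg_right (by linarith) hyy
  -- The Perron vector of `G` also maximises the form of the larger join, so it is an eigenvector of
  -- both graphs for the same value.
  have h3 := mulVec_eq_of_qForm_eq h2 (le_antisymm (h2 x) h1)
  rw [hs'.eq_cliqueJoin hx (hQ.trans h3.symm)]
  exact ⟨e⟩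

lemma Connected.qIndex_le_of_card {G : SimpleGraph V} (hG : G.Connected) :
    G.qIndex ≤ 2 * Fintype.card V - 2 := by
  have := hG.nonempty
  obtain ⟨x, hx, hQ⟩ := hG.exists_pos_eigenvector_qIndex
  have h := qForm_le_of_card (G := G) x
  rw [qForm_eq_of_mulVec_eq hQ] at h
  have hxx : 0 < x ⬝ᵥ x :=
    Finset.sum_pos (fun v _ => mul_pos (hx v) (hx v)) Finset.univ_nonempty
  have := le_of_mul_le_mul_right h hxx
  linarith

/-- If the deletion of more than `s` vertices leaves more than `b` times as many components, then
the `Q`-index is smaller than that of `K_s ∨ (K_m ∪ t K_1)`, where `b * s ≤ t < b * (s + 1)`. -/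
lemma Connected.qIndex_lt_joinCompleteUnion {G : SimpleGraph V} (hG : G.Connected) {S : Finset V}
    {b s m t : ℕ} (hb : 2 ≤ b) (hst : t < b * (s + 1)) (ht : 6 * t ≤ Fintype.card V)
    (hs : 3 * (b * (s + 1)) ≤ Fintype.card V) (hbn : 6 * b ≤ Fintype.card V)
    (hS : s < S.card) (hc : b * S.card < G.numComponentsDelete S)
    (hcard : Fintype.card V = s + m + t) :
    G.qIndex < (joinCompleteUnion s m t).qIndex := by
  classical
  by_contra! hq
  obtain ⟨x, hx, hQ⟩ := hG.exists_pos_eigenvector_qIndex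
  obtain ⟨T, w, hT, hsh, hmax⟩ := G.exists_isShift S hc x
  -- The sets `S` and `T` have `(b + 1) * |S|` vertices together and miss `w`.
  have hkn : (b + 1) * S.card < Fintype.card V := by
    have h1 : w ∉ S ∪ T := by
      rw [Finset.mem_union, not_or]; exact ⟨hsh.notMem_left, hsh.notMem_right⟩
    have h2 := Finset.card_lt_univ_of_notMem h1
    rw [Finset.card_union_of_disjoint hsh.disjoint, hT] at h2
    linarith
  have hle := hG.qIndex_le_of_card
  obtain ⟨S₀, T₀, hd₀, hS₀, hT₀, h₀⟩ :=
    exists_eq_cliqueJoin_of_iso (Iso.refl (G := joinCompleteUnion s m t))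
  have hcard₀ : Fintype.card (Fin s ⊕ (Fin m ⊕ Fin t)) = Fintype.card V := by
    rw [hcard]; simp [add_assoc]
  have hray := (joinCompleteUnion s m t).qForm_le_qIndex
  generalize (joinCompleteUnion s m t).qIndex = q at hq hray
  rw [h₀] at hray
  have hqlow := le_of_qForm_cliqueJoin_le hd₀ (by omega) hray
  rw [hcard₀, hT₀] at hqlow
  have ht' : 6 * (t : ℝ) ≤ Fintype.card V := by exact_mod_cast ht
  have hs' : 3 * ((b : ℝ) * (s + 1)) ≤ Fintype.card V := by exact_mod_cast hs
  have hb' : (2 : ℝ) ≤ b := by exact_mod_cast hb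
  have hbn' : 6 * (b : ℝ) ≤ Fintype.card V := by exact_mod_cast hbn
  have hst' : (t : ℝ) + 1 ≤ b * (s + 1) := by exact_mod_cast hst
  have hS' : (s : ℝ) + 1 ≤ S.card := by exact_mod_cast hS
  have hkn' : ((b : ℝ) + 1) * S.card < Fintype.card V := by exact_mod_cast hkn
  have hk3 : 3 * (S.card : ℝ) ≤ Fintype.card V := by nlinarith
  have hP₀ := joinPoly_nonneg_of_qForm_cliqueJoin_le hd₀ (by omega) (by omega)
    (by rw [hS₀]; linarith) hray
  rw [hcard₀, hS₀, hT₀] at hP₀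
  have hP := joinPoly_mul_pos hb' (by positivity) (by positivity) hst' ht' hs' hbn'
    (by linarith) hqlow hP₀ hS' hkn'
  have hTb : (T.card : ℝ) = b * S.card := by rw [hT]; push_cast; rfl
  rw [← hTb] at hP
  have hlt := qForm_cliqueJoin_lt hsh.disjoint (Finset.card_pos.1 (by omega)) (by
    rw [hTb]; nlinarith) (by linarith) hP hx
  have h1 := hsh.qForm_le (fun v => (hx v).le) hmax
  rw [qForm_eq_of_mulVec_eq hQ] at h1
  have hxx : 0 ≤ x ⬝ᵥ x := Finset.sum_nonneg fun v _ => mul_self_nonneg _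
  have h2 : 2 * q * (x ⬝ᵥ x) ≤ 2 * G.qIndex * (x ⬝ᵥ x) :=
    mul_le_mul_of_nonneg_right (by linarith) hxx
  linarith

end Toughness

end SimpleGraph

/-! ### The toughness theorem -/

theorem theorem1p2 {V : Type*} [Fintype V] (G : SimpleGraph V) (b l n : ℕ)
    (hb : 2 ≤ b) (hl : 2 ≤ l) (hG : G.Connected) (hn : Fintype.card V = n)
    (hnl : 6 * b * ((l - 1) ⌈/⌉ b) ≤ n)
    (hq : (SimpleGraph.joinCompleteUnion ((l - 1) / b) (n - (l - 1) / b - l + 1) (l - 1)).qIndex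
      ≤ G.qIndex) :
    1 / (b : ℝ≥0∞) ≤ G.lToughness l ↔
      ¬ Nonempty (G ≃g
        SimpleGraph.joinCompleteUnion ((l - 1) / b) (n - (l - 1) / b - l + 1) (l - 1)) := by
  obtain ⟨t, rfl⟩ : ∃ t, l = t + 1 := ⟨l - 1, by omega⟩
  rw [Nat.add_sub_cancel] at hnl hq ⊢
  obtain ⟨c, hc⟩ : ∃ c, c = t ⌈/⌉ b := ⟨_, rfl⟩
  rw [← hc] at hnl
  have htc : t ≤ b * c := by
    rw [hc]; exact le_smul_ceilDiv (by omega : 0 < b)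
  obtain ⟨s, hs⟩ : ∃ s, s = t / b := ⟨_, rfl⟩
  rw [← hs] at hq ⊢
  have hst1 : b * s ≤ t := by rw [hs]; exact Nat.mul_div_le t b
  have hst2 : t < b * (s + 1) := by rw [hs]; exact Nat.lt_mul_div_succ t (by omega)
  have hsc : s ≤ c := by
    rw [hs]; exact Nat.div_le_of_le_mul htc
  have hc1 : 1 ≤ c := by
    rcases Nat.eq_zero_or_pos c with rfl | h
    · omega
    · exact h
  -- All three bounds come from `6 * b * c ≤ n`, using `t ≤ b * c`, `1 ≤ c` and `s + 1 ≤ 2 * c`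
  -- respectively.
  have h6t : 6 * t ≤ n := by nlinarith
  have h6b : 6 * b ≤ n := by nlinarith
  have h3s : 3 * (b * (s + 1)) ≤ n := by nlinarith
  have hss : s ≤ t := by nlinarith
  -- The subtractions do not truncate: `s ≤ t`, `1 ≤ t` and `6 * t ≤ n` give `s + t + 1 ≤ n`, hence
  -- `m ≥ 1`.
  obtain ⟨m, hm⟩ : ∃ m, m = n - s - (t + 1) + 1 := ⟨_, rfl⟩
  rw [← hm] at hq ⊢
  have hcard : Fintype.card V = s + m + t := by omega
  rw [SimpleGraph.one_div_le_lToughness_iff G (by omega) (by omega)]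
  constructor
  · rintro h ⟨e⟩
    obtain ⟨S, T, hd, rfl, rfl, rfl⟩ := SimpleGraph.exists_eq_cliqueJoin_of_iso e
    have h1 := SimpleGraph.card_lt_numComponentsDelete_cliqueJoin hd (by omega)
    have h2 := h S h1
    omega
  · intro hne S hS
    by_contra! hcon
    rcases Nat.lt_or_ge s S.card with hlt | hge
    · exact absurd hq (not_le.2 (hG.qIndex_lt_joinCompleteUnion hb hst2 (by omega) (by omega)
        (by omega) hlt hcon hcard))
    · exact hne (hG.nonempty_iso_of_qIndex_le hge hS (by omega) hcard hq)
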